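/- **Model.** A network consists of $n$ agents on a circle of circumference one, at distinct initial positions, with distinct identifiers from $[N]=\{1,\dots,N\}$. Each agent has its own sense of direction: what it calls "right" (clockwise) may or may not be the objective clockwise direction. The agents act in synchronised rounds of unit duration. In a round of the *basic model* every agent starts moving at unit speed either to its right or to its left (idling is not allowed); two colliding agents instantly reverse their directions, so agents never overpass. At the end of a round an agent learns only the distance in $[0,1)$, measured in its own clockwise direction, from its position at the beginning of the round to its position at the end. A *deterministic protocol* is a rule, the same for all agents and possibly depending on $N$, by which an agent computes from its identifier and the distances it has observed so far its next direction $\mathrm{dir}_a\in\{\text{left},\text{right}\}$ and whether it terminates. The *rotation index* of a round is the $r\in\{0,\dots,n-1\}$ such that in this round every agent moves by $r$ places clockwise along the initial positions of the round. The round is a *nontrivial move* if $r\notin\{0,n/2\}$. A protocol *solves the nontrivial move problem within $T$ rounds* in a network if after some $t\le T$ rounds all agents terminate simultaneously (none having terminated earlier), with directions $\mathrm{dir}_a$ such that a round which every agent $a$ starts in the direction $\mathrm{dir}_a$ is a nontrivial move. **Theorem.** There is an absolute constant $C$ such that, with $$T(N,n)=C\cdot\frac{n\,(1+\log(N/n))}{\log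 n},$$ the following hold in the basic model. 1. (Known $n$.) For all $N\ge n>4$ there is a deterministic protocol that solves the nontrivial move problem within $T(N,n)$ rounds in every network of $n$ agents with identifiers from $[N]$. 2. (Unknown $n$.) For every $N$ there is one deterministic protocol that, for every $n$ with $4<n\le N$, solves the nontrivial move problem within $T(N,n)$ rounds in every network of $n$ agents with identifiers from $[N]$. -/

import Mathlib

/-!
Bouncing agents on a circle of circumference one: the basic model.

Circle positions are elements of `UnitAddCircle = ℝ / ℤ`; the positive direction is the objective
clockwise direction, also called "right". The `n` agents are indexed by `ZMod n` in clockwise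
order, so `i + 1` is the next agent clockwise from `i`. Indices are not disclosed to the agents.
-/

namespace RingNetwork

/-- A direction of movement. In the basic model idling is not allowed. -/
inductive Dir : Type
  | left
  | right

/-- The opposite direction. -/
def Dir.opp : Dir → Dir
  | .left => .right
  | .right => .left

/-- The velocity (unit speed) of an agent moving in a given objective direction. -/
def Dir.velocity : Dir → ℝ
  | .left => -1
  | .right => 1

/-! ### Movement within one round -/

/-- Positions of the agents, and the objective directions in which they currently move. -/
structure State (n : ℕ) where
  pos : ZMod n → UnitAddCircle
  dir : ZMod n → Dir

/-- Free movement of all the agents, at unit speed, for `t` units of time. -/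
noncomputable def State.drift {n : ℕ} (s : State n) (t : ℝ) : State n where
  pos := fun i => s.pos i + ((t * (s.dir i).velocity : ℝ) : UnitAddCircle)
  dir := s.dir

/-- Agent `i` and the next agent clockwise, `i + 1`, are colliding: they are at the same point
and move towards each other. -/
def State.Colliding {n : ℕ} (s : State n) (i : ZMod n) : Prop :=
  s.pos i = s.pos (i + 1) ∧ s.dir i = Dir.right ∧ s.dir (i + 1) = Dir.left

open Classical in
/-- The agents `i` and `i + 1` reverse their directions. -/
noncomputable def State.bounce {n : ℕ} (s : State n) (i : ZMod n) : State n where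
  pos := s.pos
  dir := fun j => if j = i ∨ j = i + 1 then (s.dir j).opp else s.dir j

/-- `Motion s T s'`: the agents get from state `s` to state `s'` in `T` units of time. They move
freely as long as nobody is colliding, and colliding agents instantly reverse their directions
(so agents never overpass each other). -/
inductive Motion {n : ℕ} : State n → ℝ → State n → Prop
  | refl (s : State n) : Motion s 0 s
  | drift {s s' : State n} {τ T : ℝ} (nonneg : 0 ≤ τ)
      (free : ∀ t : ℝ, 0 ≤ t → t < τ → ∀ i : ZMod n, ¬ (s.drift t).Colliding i)
      (rest : Motion (s.drift τ) T s') : Motion s (τ + T) s'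
  | bounce {s s' : State n} {T : ℝ} (i : ZMod n) (coll : s.Colliding i)
      (rest : Motion (s.bounce i) T s') : Motion s T s'

/-- If the agents start a round at the positions `p` in the objective directions `d`, then they
may be at the positions `p'` at the end of the round, which lasts one unit of time. -/
def Round {n : ℕ} (p : ZMod n → UnitAddCircle) (d : ZMod n → Dir)
    (p' : ZMod n → UnitAddCircle) : Prop :=
  ∃ d' : ZMod n → Dir, Motion ⟨p, d⟩ 1 ⟨p', d'⟩

/-- The round started at the positions `p` in the objective directions `d` has rotation index `r`:
its one and only outcome is that each agent moves by `r` places clockwise. -/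
def HasRotationIndex {n : ℕ} (p : ZMod n → UnitAddCircle) (d : ZMod n → Dir) (r : ZMod n) : Prop :=
  ∀ p' : ZMod n → UnitAddCircle, Round p d p' ↔ ∀ i : ZMod n, p' i = p (i + r)

/-- The round started at the positions `p` in the objective directions `d` is a nontrivial move:
its rotation index is neither `0` nor `n / 2`. -/
def IsNontrivialMove {n : ℕ} (p : ZMod n → UnitAddCircle) (d : ZMod n → Dir) : Prop :=
  ∃ r : ZMod n, HasRotationIndex p d r ∧ r.val ≠ 0 ∧ 2 * r.val ≠ n

/-! ### Networks and protocols -/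

/-- The points `p i`, `i : ZMod n`, are distinct and listed in clockwise order, going once around
the circle: `q` enumerates their lifts to the real line in increasing order. -/
def IsClockwise {n : ℕ} (p : ZMod n → UnitAddCircle) : Prop :=
  ∃ q : ℤ → ℝ, StrictMono q ∧ (∀ k : ℤ, q (k + n) = q k + 1) ∧
    ∀ k : ℤ, p (k : ZMod n) = (q k : UnitAddCircle)

/-- A network of `n` agents with distinct identifiers from `{1, …, N}`, with arbitrary initial
positions and arbitrary individual senses of direction. -/
structure Network (N n : ℕ) where
  /-- initial positions -/
  pos : ZMod n → UnitAddCircle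
  clockwise : IsClockwise pos
  id : ZMod n → ℕ
  id_injective : Function.Injective id
  id_mem : ∀ i, id i ∈ Finset.Icc 1 N
  /-- whether the agent's own clockwise direction is the objective clockwise direction -/
  aligned : ZMod n → Bool

/-- The objective direction that an agent calls `d`. -/
def objective (aligned : Bool) (d : Dir) : Dir :=
  if aligned then d else d.opp

/-- The distance, in `[0, 1)`, from `x` to `y` in the agent's own clockwise direction. -/
noncomputable def rightDist (aligned : Bool) (x y : UnitAddCircle) : ℝ :=
  if aligned then (AddCircle.equivIco 1 0 (y - x) : ℝ) else (AddCircle.equivIco 1 0 (x - y) : ℝ)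

/-- A deterministic protocol, executed by every agent. All that an agent can use is its identifier
and the list, in chronological order, of the distances `rightDist` between its positions at the
beginning and at the end of the rounds performed so far. From these it computes the value of its
direction variable, in terms of its own sense of direction, and whether it has terminated. -/
structure Protocol where
  dir : ℕ → List ℝ → Dir
  terminated : ℕ → List ℝ → Prop

/-- What agent `i` has observed in the first `t` rounds, if `x s` are the positions after
`s` rounds. -/
noncomputable def Network.history {N n : ℕ} (A : Network N n) (x : ℕ → ZMod n → UnitAddCircle)
    (t : ℕ) (i : ZMod n) : List ℝ :=
  (List.range t).map fun s => rightDist (A.aligned i) (x s i) (x (s + 1) i)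

/-- The objective directions given by the direction variables of the agents after `t` rounds. -/
noncomputable def Protocol.directions (P : Protocol) {N n : ℕ} (A : Network N n)
    (x : ℕ → ZMod n → UnitAddCircle) (t : ℕ) (i : ZMod n) : Dir :=
  objective (A.aligned i) (P.dir (A.id i) (A.history x t i))

/-- `x` is an execution of `P` in the network `A`, where `x t i` is the position of agent `i` after
`t` rounds. (After termination the agents go on moving according to their direction variables.) -/
def Protocol.IsExecution (P : Protocol) {N n : ℕ} (A : Network N n)
    (x : ℕ → ZMod n → UnitAddCircle) : Prop :=
  x 0 = A.pos ∧ ∀ t : ℕ, Round (x t) (P.directions A x t) (x (t + 1))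

/-- `P` solves the nontrivial move problem in the network `A` in at most `T` rounds: in its
execution there is a time `t ≤ T` at which all the agents terminate, none of them having terminated
before, and at which the values of the direction variables are such that a round started in these
directions is a nontrivial move. -/
def Protocol.SolvesNontrivialMove (P : Protocol) {N n : ℕ} (A : Network N n) (T : ℝ) : Prop :=
  (∃ x, P.IsExecution A x) ∧
  ∀ x, P.IsExecution A x → ∃ t : ℕ, (t : ℝ) ≤ T ∧
    (∀ s < t, ∀ i, ¬ P.terminated (A.id i) (A.history x s i)) ∧
    (∀ i, P.terminated (A.id i) (A.history x t i)) ∧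
    IsNontrivialMove (x t) (P.directions A x t)

end RingNetwork

/-! In a unit-length round every free trajectory closes up, so bouncing only permutes the starting
points. Because cyclic order is kept, the permutation is a rotation, and following the sum of the
lifted positions shows that its index is the number of objective right-movers minus that of
left-movers (`Round.eq_rotation`). With `l` left-movers the round is therefore nontrivial exactly
when `n ∤ 4 * l`.

The protocol tries a fixed sequence of sets `S` of identifiers: members go to their own right, the
others to their own left, twice in a row. The two rounds rotate everyone by `2r`, so an agent is
back home iff the move is trivial. All agents see this alike and stop together (`testing_solves`).

The sequence comes from the probabilistic method. What matters in a network is only the set `X` of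
identifiers and the subset `A` of aligned ones. A random `S` fails for `(X, A)` with probability at
most `n ^ (-1/256)` (`trivialProb_le_exp`), while there are at most `exp (n * (1 + log (N / n))) * 2
^ n` such pairs of size `n`. About `n * (1 + log (N / n)) / log n` trials thus beat a union bound,
with enough room to sum over all `n` at once; so one sequence serves every `n`, and the case of
known `n` follows. -/

namespace RingNetwork

/-! ### Lifts to the real line and the rotation index of a round -/

section

/-- The displacement, in full turns, of an agent moving freely for one round. -/
def Dir.sign : Dir → ℤ
  | .left => -1
  | .right => 1

theorem Dir.velocity_eq (d : Dir) : d.velocity = (d.sign : ℝ) := by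
  cases d <;> simp [Dir.velocity, Dir.sign]

variable {n : ℕ}

/-- The real numbers `z k + k / n`, for integers `k`, are lifts of the points `p k`, and they are
weakly increasing. -/
structure Lifts (z : ZMod n → ℝ) (p : ZMod n → UnitAddCircle) : Prop where
  le : ∀ i, z i ≤ z (i + 1) + 1 / n
  coe : ∀ k : ℤ, p k = ((z k + k / n : ℝ) : UnitAddCircle)

theorem Lifts.monotone {z : ZMod n → ℝ} {p : ZMod n → UnitAddCircle} (h : Lifts z p) :
    Monotone fun k : ℤ => z k + k / n := by
  refine monotone_int_of_le_succ fun k => ?_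
  have := h.le k
  push_cast
  rw [add_div]
  linarith

/-- The distance from agent `i` to agent `i + 1`, in the lift `z`. -/
noncomputable def gap (z : ZMod n → ℝ) (i : ZMod n) : ℝ := z (i + 1) + 1 / n - z i

theorem Lifts.gap_nonneg {z : ZMod n → ℝ} {p : ZMod n → UnitAddCircle} (h : Lifts z p)
    (i : ZMod n) : 0 ≤ gap z i := by
  have := h.le i
  unfold gap
  linarith

theorem Lifts.coe_gap {z : ZMod n → ℝ} {p : ZMod n → UnitAddCircle} (h : Lifts z p)
    (i : ZMod n) : (gap z i : UnitAddCircle) = p (i + 1) - p i := by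
  obtain ⟨k, rfl⟩ := ZMod.intCast_surjective i
  have h1 := h.coe (k + 1)
  push_cast at h1
  rw [h1, h.coe k, ← AddCircle.coe_sub, gap]
  congr 1
  ring

theorem State.Colliding.bounce_dir {s : State n} {i : ZMod n} (h : s.Colliding i) :
    (s.bounce i).dir = s.dir ∘ Equiv.swap i (i + 1) := by
  obtain ⟨-, h1, h2⟩ := h
  funext j
  by_cases hj : j = i
  · simp [State.bounce, hj, h1, h2, Dir.opp]
  by_cases hj' : j = i + 1
  · subst hj'
    simp [State.bounce, h1, h2, Dir.opp]
  · simp [State.bounce, hj, hj', Equiv.swap_apply_of_ne_of_ne]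

theorem State.Colliding.pos_swap {s : State n} {i : ZMod n} (h : s.Colliding i) (j : ZMod n) :
    s.pos (Equiv.swap i (i + 1) j) = s.pos j := by
  by_cases hj : j = i
  · simp [hj, h.1]
  by_cases hj' : j = i + 1
  · simp [hj', h.1]
  · rw [Equiv.swap_apply_of_ne_of_ne hj hj']

theorem State.Colliding.ne {s : State n} {i : ZMod n} (h : s.Colliding i) : i ≠ i + 1 := by
  intro hi
  have h2 := h.2.2
  rw [← hi, h.2.1] at h2
  cases h2

/-- Up to a permutation, the agents pass through each other. -/
theorem Motion.exists_perm {s s' : State n} {T : ℝ} (h : Motion s T s') :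
    ∃ σ : Equiv.Perm (ZMod n), ∀ i, s'.dir i = s.dir (σ i) ∧
      s'.pos i = s.pos (σ i) + ((T * (s.dir (σ i)).velocity : ℝ) : UnitAddCircle) := by
  induction h with
  | refl s => exact ⟨1, fun i => by simp⟩
  | @drift s s' τ T _ _ _ ih =>
    obtain ⟨σ, hσ⟩ := ih
    refine ⟨σ, fun i => ⟨(hσ i).1, ?_⟩⟩
    rw [(hσ i).2]
    simp only [State.drift, add_mul, AddCircle.coe_add, add_assoc]
  | @bounce s s' T i coll _ ih =>
    obtain ⟨σ, hσ⟩ := ih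
    refine ⟨σ.trans (Equiv.swap i (i + 1)), fun j => ?_⟩
    have := hσ j
    rw [coll.bounce_dir] at this
    simp only [Equiv.trans_apply, coll.pos_swap]
    exact this

/-- Only the gap of a pair moving towards each other shrinks, at rate 2, so order survives until the
first such gap closes. -/
theorem Lifts.drift {s : State n} {z : ZMod n → ℝ} (h : Lifts z s.pos) {τ : ℝ} (hτ : 0 ≤ τ)
    (hgap : ∀ i, s.dir i = Dir.right → s.dir (i + 1) = Dir.left → 2 * τ ≤ gap z i) :
    Lifts (fun i => z i + τ * (s.dir i).velocity) (s.drift τ).pos := by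
  refine ⟨fun i => ?_, fun k => ?_⟩
  · have h0 := h.le i
    have h1 := hgap i
    unfold gap at h1
    cases hi : s.dir i <;> cases hi' : s.dir (i + 1) <;>
      simp only [hi, hi', Dir.velocity, forall_const] at h1 ⊢ <;>
      linarith
  · simp only [State.drift]
    rw [h.coe k, ← AddCircle.coe_add]
    congr 1
    ring

theorem State.colliding_drift_iff {s : State n} {t : ℝ} {i : ZMod n} :
    (s.drift t).Colliding i ↔ s.pos (i + 1) - s.pos i = ((2 * t : ℝ) : UnitAddCircle) ∧
      s.dir i = Dir.right ∧ s.dir (i + 1) = Dir.left := by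
  simp only [State.Colliding, State.drift]
  refine and_congr_left fun ⟨h1, h2⟩ => ?_
  rw [h1, h2]
  simp only [Dir.velocity, two_mul, AddCircle.coe_add, mul_one, mul_neg, AddCircle.coe_neg]
  constructor <;> intro h
  · rw [← sub_eq_zero] at h ⊢
    rw [← neg_eq_zero, ← h]
    abel
  · rw [← sub_eq_zero] at h ⊢
    rw [← neg_eq_zero, ← h]
    abel

/-- This invariant, that agents at one point differ in direction, rules out triple meetings in
`gap_eq_zero_of_colliding`. -/
theorem injective_drift {s : State n} (hinj : Function.Injective fun i => (s.pos i, s.dir i))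
    (t : ℝ) : Function.Injective fun i => ((s.drift t).pos i, (s.drift t).dir i) := by
  intro i j hij
  simp only [State.drift, Prod.mk.injEq] at hij
  refine hinj ?_
  obtain ⟨h1, h2⟩ := hij
  rw [h2] at h1
  simp only [h2, add_right_cancel h1]

theorem injective_bounce {s : State n} (hinj : Function.Injective fun i => (s.pos i, s.dir i))
    {i : ZMod n} (h : s.Colliding i) :
    Function.Injective fun j => ((s.bounce i).pos j, (s.bounce i).dir j) := by
  have : (fun j => ((s.bounce i).pos j, (s.bounce i).dir j)) =
      (fun j => (s.pos j, s.dir j)) ∘ Equiv.swap i (i + 1) := by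
    funext j
    rw [h.bounce_dir]
    simp [State.bounce, h.pos_swap]
  rw [this]
  exact hinj.comp (Equiv.injective _)

variable [NeZero n]

theorem sum_velocity_bounce {s : State n} {i : ZMod n} (h : s.Colliding i) :
    ∑ j, ((s.bounce i).dir j).velocity = ∑ j, (s.dir j).velocity := by
  rw [h.bounce_dir]
  exact Equiv.sum_comp (Equiv.swap i (i + 1)) fun j => (s.dir j).velocity

/-- A bounce swaps two velocities and moves nobody, so the total velocity is conserved and the sum
of the lifts grows linearly. -/
theorem Motion.exists_lifts {s s' : State n} {T : ℝ} (h : Motion s T s') :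
    ∀ z : ZMod n → ℝ, Lifts z s.pos → ∃ z', Lifts z' s'.pos ∧
      ∑ i, z' i = ∑ i, z i + T * ∑ i, (s.dir i).velocity := by
  induction h with
  | refl s => exact fun z hz => ⟨z, hz, by simp⟩
  | @drift s s' τ T nonneg free _ ih =>
    intro z hz
    obtain ⟨z', h1, h2⟩ := ih (fun i => z i + τ * (s.dir i).velocity) <| by
      refine hz.drift nonneg fun i hi hi' => ?_
      by_contra! hlt
      refine free (gap z i / 2) (by linarith [hz.gap_nonneg i]) (by linarith) i ?_
      rw [State.colliding_drift_iff, mul_div_cancel₀ _ two_ne_zero, hz.coe_gap]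
      exact ⟨rfl, hi, hi'⟩
    refine ⟨z', h1, ?_⟩
    rw [h2, Finset.sum_add_distrib, ← Finset.mul_sum]
    simp only [State.drift]
    ring
  | @bounce s s' T i coll _ ih =>
    intro z hz
    rw [← sum_velocity_bounce coll]
    exact ih z hz

theorem Lifts.exists_eq {z : ZMod n → ℝ} {p : ZMod n → UnitAddCircle} (h : Lifts z p) {y : ℝ}
    {i : ZMod n} (hy : (y : UnitAddCircle) = p i) : ∃ k : ℤ, (k : ZMod n) = i ∧ y = z k + k / n := by
  obtain ⟨k, rfl⟩ := ZMod.intCast_surjective i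
  rw [h.coe k, ← sub_eq_zero, ← AddCircle.coe_sub, AddCircle.coe_eq_zero_iff] at hy
  obtain ⟨m, hm⟩ := hy
  have hk : ((k + m * n : ℤ) : ZMod n) = k := by simp
  have hn : (n : ℝ) ≠ 0 := NeZero.ne _
  refine ⟨k + m * n, hk, ?_⟩
  rw [hk]
  simp only [zsmul_eq_mul, mul_one] at hm
  push_cast
  rw [add_div, mul_div_cancel_right₀ _ hn]
  linarith

theorem Lifts.strictMono {z : ZMod n → ℝ} {p : ZMod n → UnitAddCircle} (h : Lifts z p)
    (hp : Function.Injective p) : StrictMono fun k : ℤ => z k + k / n := by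
  refine h.monotone.strictMono_of_injective fun k l hkl => ?_
  have hkl' : z k + k / n = z l + l / n := hkl
  have h1 : (k : ZMod n) = l := hp (by rw [h.coe, h.coe, hkl'])
  rw [h1, add_right_inj, div_left_inj' (NeZero.ne _)] at hkl'
  exact_mod_cast hkl'

theorem exists_add_of_surjective {φ : ℤ → ℤ} (hφ : StrictMono φ) (hs : Function.Surjective φ) :
    ∃ c, ∀ k, φ k = k + c := by
  let e := hφ.orderIsoOfSurjective φ hs
  refine ⟨φ 0, fun k => ?_⟩
  have h1 : ∀ k, φ (k + 1) = φ k + 1 := fun k => e.map_succ k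
  induction k using Int.induction_on with
  | zero => simp
  | succ k ih => rw [h1, ih]; ring
  | pred k ih =>
    have := h1 (-k - 1)
    rw [sub_add_cancel, ih] at this
    linarith

/-- The rotation index, as an integer, of a round started in the directions `d`. -/
def rotation (d : ZMod n → Dir) : ℤ := ∑ i, (d i).sign

/-- Initial and final lifts are increasing enumerations of the same subset of `ℝ`, hence differ by
an index shift `c`. The shift changes the sum of the lifts by `n * (c / n) = c`, which must equal
the total velocity. -/
theorem Round.eq_rotation {p p' : ZMod n → UnitAddCircle} {d : ZMod n → Dir} {z : ZMod n → ℝ}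
    (hz : Lifts z p) (hp : Function.Injective p) (h : Round p d p') (i : ZMod n) :
    p' i = p (i + (rotation d : ℤ)) := by
  obtain ⟨d', h⟩ := h
  obtain ⟨σ, hσ⟩ := h.exists_perm
  obtain ⟨z', hz', hsum⟩ := h.exists_lifts z hz
  have hσ' : ∀ i, p' i = p (σ i) := fun i => by
    have h1 : ((d (σ i)).velocity : UnitAddCircle) = 0 := by
      rw [AddCircle.coe_eq_zero_iff]
      exact ⟨(d (σ i)).sign, by simp [Dir.velocity_eq]⟩
    have h2 := (hσ i).2
    rwa [one_mul, h1, add_zero] at h2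
  have hp' : Function.Injective p' := fun i j hij => by
    rw [hσ', hσ'] at hij
    exact σ.injective (hp hij)
  have hq := hz.strictMono hp
  have hq' := hz'.strictMono hp'
  have hex : ∀ k : ℤ, ∃ l : ℤ, z' k + k / n = z l + l / n := fun k => by
    obtain ⟨l, -, hl⟩ := hz.exists_eq (i := σ k) (y := z' k + k / n) (by
      rw [← hσ', ← hz'.coe])
    exact ⟨l, hl⟩
  choose φ hφ using hex
  obtain ⟨c, hc⟩ := exists_add_of_surjective (φ := φ)
    (fun k l hkl => hq.lt_iff_lt.1 (by
      have := hq' hkl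
      simp only [hφ] at this
      exact this))
    (fun l => by
      obtain ⟨k, -, hk⟩ := hz'.exists_eq (i := σ.symm l) (y := z l + l / n) (by
        exact (hz.coe l).symm.trans (by simp only [hσ', Equiv.apply_symm_apply]))
      exact ⟨k, hq.injective (by simp only [← hφ, hk])⟩)
  have hn : (n : ℝ) ≠ 0 := NeZero.ne _
  have hshift : ∀ i : ZMod n, z' i = z (i + c) + c / n := fun i => by
    obtain ⟨k, rfl⟩ := ZMod.intCast_surjective i
    have h1 := hφ k
    rw [hc] at h1
    push_cast at h1
    rw [add_div] at h1
    linarith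
  have hcr : c = rotation d := by
    rw [Finset.sum_congr rfl fun i _ => hshift i, Finset.sum_add_distrib,
      show ∑ i, z (i + c) = ∑ i, z i from Equiv.sum_comp (Equiv.addRight (c : ZMod n)) z,
      one_mul] at hsum
    simp only [Finset.sum_const, Finset.card_univ, ZMod.card, nsmul_eq_mul, add_right_inj,
      mul_div_cancel₀ _ hn, Dir.velocity_eq] at hsum
    unfold rotation
    exact_mod_cast hsum
  obtain ⟨k, rfl⟩ := ZMod.intCast_surjective i
  have h1 := hz'.coe k
  have h2 := hz.coe (k + c)
  rw [hφ, hc] at h1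
  rw [← hcr, ← Int.cast_add, h2]
  exact h1

/-! ### Existence of the motion -/

/-- Equality of positions on the circle only makes the gap an integer. If it were at least 1, it
would use up the whole circle, agent `k + 2` would sit at the same point too, and it would share its
direction with one of the colliding two. -/
theorem gap_eq_zero_of_colliding (hn : 2 < n) {s : State n} {z : ZMod n → ℝ}
    (hz : Lifts z s.pos) (hinj : Function.Injective fun i => (s.pos i, s.dir i)) {i : ZMod n}
    (h : s.Colliding i) : gap z i = 0 := by
  obtain ⟨k, rfl⟩ := ZMod.intCast_surjective i
  have hn0 : (n : ℝ) ≠ 0 := NeZero.ne _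
  have hmono := hz.monotone
  have hg := hz.coe_gap k
  rw [← h.1, sub_self, AddCircle.coe_eq_zero_iff] at hg
  obtain ⟨m, hm⟩ := hg
  simp only [zsmul_eq_mul, mul_one] at hm
  have hgk := hz.gap_nonneg k
  have h12 : z (k + 1 : ℤ) + (k + 1 : ℤ) / n ≤ z (k + 2 : ℤ) + (k + 2 : ℤ) / n :=
    hmono (by omega)
  have h2n : z (k + 2 : ℤ) + (k + 2 : ℤ) / n ≤ z (k + n : ℤ) + (k + n : ℤ) / n :=
    hmono (by omega)
  have hkn : z (k + n : ℤ) + (k + n : ℤ) / n = z k + k / n + 1 := by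
    push_cast
    rw [ZMod.natCast_self, add_zero, add_div, div_self hn0]
    ring
  have hk1 : z (k + 1 : ℤ) + (k + 1 : ℤ) / n = z k + k / n + gap z k := by
    unfold gap
    push_cast
    ring
  by_contra hne
  have hm1 : (1 : ℝ) ≤ gap z k := by
    rw [← hm] at hgk hne ⊢
    have h0 : m ≠ 0 := by exact_mod_cast hne
    have h1 : 0 ≤ m := by exact_mod_cast hgk
    exact_mod_cast (show 1 ≤ m by omega)
  have h21 : s.pos (k + 2 : ℤ) = s.pos (k + 1 : ℤ) := by
    rw [hz.coe, hz.coe, le_antisymm (by linarith) h12]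
  push_cast at h21
  have hone : (1 : ZMod n) ≠ 0 := by
    have : Fact (1 < n) := ⟨by omega⟩
    exact one_ne_zero
  have htwo : (2 : ZMod n) ≠ 0 := by
    have : ((2 : ℕ) : ZMod n) ≠ 0 := by
      rw [Ne, ZMod.natCast_eq_zero_iff]
      exact fun hd => absurd (Nat.le_of_dvd two_pos hd) (by omega)
    exact_mod_cast this
  cases hd : s.dir (k + 2) with
  | right =>
    have : (k : ZMod n) + 2 = k := hinj (by simp only [h21, hd, ← h.1, h.2.1])
    exact htwo (by simpa using this)
  | left =>
    have : (k : ZMod n) + 2 = k + 1 := hinj (by simp only [h21, hd, h.2.2])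
    have h3 : (2 : ZMod n) = 1 := by simpa using this
    exact hone (by linear_combination h3)

theorem sum_mul_velocity_bounce {s : State n} {z : ZMod n → ℝ} {i : ZMod n}
    (h : s.Colliding i) (hgap : gap z i = 0) :
    ∑ j, z j * ((s.bounce i).dir j).velocity = ∑ j, z j * (s.dir j).velocity + -(2 / n) := by
  rw [← sub_eq_iff_eq_add', ← Finset.sum_sub_distrib, Fintype.sum_eq_add i (i + 1) h.ne]
  · simp only [State.bounce, true_or, or_true, if_true, h.2.1, h.2.2, Dir.opp, Dir.velocity]
    unfold gap at hgap
    rw [div_eq_mul_one_div]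
    linarith
  · intro j hj
    simp [State.bounce, hj.1, hj.2]

theorem not_colliding_drift (hn : 2 < n) {s : State n} {z : ZMod n → ℝ} (hz : Lifts z s.pos)
    (hinj : Function.Injective fun i => (s.pos i, s.dir i)) {τ : ℝ}
    (hgap : ∀ i, s.dir i = Dir.right → s.dir (i + 1) = Dir.left → 2 * τ ≤ gap z i) (t : ℝ)
    (h0 : 0 ≤ t) (ht : t < τ) (i : ZMod n) : ¬ (s.drift t).Colliding i := by
  intro h
  have h1 := gap_eq_zero_of_colliding hn
    (hz.drift h0 fun j hj hj' => by linarith [hgap j hj hj']) (injective_drift hinj t) h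
  obtain ⟨-, hi, hi'⟩ := h
  simp only [State.drift] at hi hi'
  have h2 := hgap i hi hi'
  simp only [gap, hi, hi', Dir.velocity] at h1 h2
  linarith

/-- Collisions are finite in number: the potential `∑ z v + n T`, with `T` the remaining time, is
constant under drift, drops by `2 / n` at each bounce, and is at least `-n B`. Induction is on the
number `m` of drops still affordable. -/
theorem exists_motion_of_lt (hn : 2 < n) {B : ℝ} (m : ℕ) :
    ∀ (s : State n) (z : ZMod n → ℝ) (T : ℝ), 0 ≤ T → Lifts z s.pos →
      (Function.Injective fun i => (s.pos i, s.dir i)) → (∀ i, |z i| ≤ B - T) →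
      ∑ i, z i * (s.dir i).velocity + n * T < m * (2 / n) - n * B → ∃ s', Motion s T s' := by
  have hn0 : (n : ℝ) ≠ 0 := NeZero.ne _
  induction m with
  | zero =>
    intro s z T hT hz hinj hB hlt
    have : ∑ i, -(B - T) ≤ ∑ i, z i * (s.dir i).velocity := Finset.sum_le_sum fun i _ => by
      have := abs_le.1 (hB i)
      cases s.dir i <;> simp only [Dir.velocity] <;> linarith
    simp only [Finset.sum_const, Finset.card_univ, ZMod.card, nsmul_eq_mul] at this
    have hnT : 0 ≤ n * T := by positivity
    push_cast at hlt
    linarith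
  | succ m ih =>
    intro s z T hT hz hinj hB hlt
    classical
    rcases (Finset.univ.filter fun i => s.dir i = Dir.right ∧ s.dir (i + 1) = Dir.left ∧
      gap z i < 2 * T).eq_empty_or_nonempty with hR | hR
    · have hgap : ∀ i, s.dir i = Dir.right → s.dir (i + 1) = Dir.left → 2 * T ≤ gap z i := by
        intro i h1 h2
        by_contra! h3
        exact Finset.filter_eq_empty_iff.1 hR (Finset.mem_univ i) ⟨h1, h2, h3⟩
      have := Motion.drift hT (not_colliding_drift hn hz hinj hgap) (Motion.refl _)
      rw [add_zero] at this
      exact ⟨_, this⟩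
    -- Otherwise drift to the first collision, at half the smallest closing gap, and bounce.
    obtain ⟨i, hi, hmin⟩ := Finset.exists_min_image _ (gap z) hR
    simp only [Finset.mem_filter, Finset.mem_univ, true_and] at hi hmin
    obtain ⟨hr, hl, hlt'⟩ := hi
    obtain ⟨τ, hτ⟩ : ∃ τ, gap z i = 2 * τ := ⟨gap z i / 2, by ring⟩
    have hτ0 : 0 ≤ τ := by linarith [hz.gap_nonneg i]
    have hgap : ∀ j, s.dir j = Dir.right → s.dir (j + 1) = Dir.left → 2 * τ ≤ gap z j := by
      intro j h1 h2
      by_cases h3 : gap z j < 2 * T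
      · exact hτ ▸ hmin j ⟨h1, h2, h3⟩
      · linarith
    have hcoll : (s.drift τ).Colliding i := by
      rw [State.colliding_drift_iff, ← hz.coe_gap, hτ]
      exact ⟨rfl, hr, hl⟩
    have hz' := hz.drift hτ0 hgap
    have hinj' := injective_drift hinj τ
    have hgap' := gap_eq_zero_of_colliding hn hz' hinj' hcoll
    obtain ⟨s', hs'⟩ := ih ((s.drift τ).bounce i) _ (T - τ) (by linarith) hz'
      (injective_bounce hinj' hcoll) (fun j => by
        have := abs_le.1 (hB j)
        rw [abs_le]
        cases s.dir j <;> simp only [Dir.velocity] <;> constructor <;> linarith) (by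
        rw [sum_mul_velocity_bounce hcoll hgap']
        have h1 : ∑ j, (z j + τ * (s.dir j).velocity) * ((s.drift τ).dir j).velocity =
            ∑ j, z j * (s.dir j).velocity + n * τ := by
          rw [show (n : ℝ) * τ = ∑ _j : ZMod n, τ by simp [ZMod.card], ← Finset.sum_add_distrib]
          refine Finset.sum_congr rfl fun j _ => ?_
          simp only [State.drift]
          cases s.dir j <;> simp only [Dir.velocity] <;> ring
        rw [h1]
        push_cast at hlt
        linarith)
    have := Motion.drift hτ0 (not_colliding_drift hn hz hinj hgap) (Motion.bounce i hcoll hs')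
    rw [add_sub_cancel] at this
    exact ⟨s', this⟩

theorem exists_round (hn : 2 < n) {p : ZMod n → UnitAddCircle} (d : ZMod n → Dir)
    {z : ZMod n → ℝ} (hz : Lifts z p) (hp : Function.Injective p) : ∃ p', Round p d p' := by
  obtain ⟨B, hB⟩ := Finite.exists_le fun i => |z i|
  have hn0 : (0 : ℝ) < 2 / n := div_pos two_pos (Nat.cast_pos.2 (by omega))
  obtain ⟨m, hm⟩ := Archimedean.arch
    (∑ i, z i * (d i).velocity + n * 1 + n * (B + 1) + 1) hn0
  rw [nsmul_eq_mul] at hm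
  obtain ⟨s', hs'⟩ := exists_motion_of_lt hn (B := B + 1) m ⟨p, d⟩ z 1 zero_le_one hz
    (fun i j hij => hp (congrArg Prod.fst hij)) (fun i => by simpa using hB i)
    (by linarith)
  exact ⟨s'.pos, s'.dir, hs'⟩

/-! ### Clockwise configurations and their rotation index -/

theorem IsClockwise.exists_lifts {p : ZMod n → UnitAddCircle} (h : IsClockwise p) :
    Function.Injective p ∧ ∃ z, Lifts z p := by
  obtain ⟨q, hq, hper, hcoe⟩ := h
  have hn : (n : ℝ) ≠ 0 := NeZero.ne _
  have hper' : ∀ m k : ℤ, q (k + m * n) = q k + m := by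
    intro m
    induction m using Int.induction_on with
    | zero => simp
    | succ m ih =>
      intro k
      rw [show k + (m + 1) * n = k + m * n + n by ring, hper, ih]
      push_cast
      ring
    | pred m ih =>
      intro k
      have := hper (k + (-m - 1) * n)
      rw [show k + (-m - 1) * n + n = k + -m * n by ring, ih] at this
      push_cast at this ⊢
      linarith
  -- `q k - k / n` is `n`-periodic, so it descends to `ZMod n`.
  have hval : ∀ k : ℤ, q ((k : ZMod n).val : ℤ) - (k : ZMod n).val / n = q k - k / n := by
    intro k
    have h1 := Int.emod_add_mul_ediv k n
    have h2 := hper' (k / n) (k % n)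
    rw [mul_comm, h1] at h2
    have h3 : ((k : ZMod n).val : ℝ) = ((k % n : ℤ) : ℝ) := by
      rw [← ZMod.val_intCast]
      simp
    have h4 : (k : ℝ) = ((k % n : ℤ) : ℝ) + n * ((k / n : ℤ) : ℝ) := by exact_mod_cast h1.symm
    rw [h3, ZMod.val_intCast, h2, eq_sub_iff_add_eq, h4, add_div, mul_div_cancel_left₀ _ hn]
    ring
  refine ⟨fun i j hij => ?_, fun i => q i.val - i.val / n, fun i => ?_, fun k => ?_⟩
  · obtain ⟨k, rfl⟩ := ZMod.intCast_surjective i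
    obtain ⟨l, rfl⟩ := ZMod.intCast_surjective j
    rw [hcoe, hcoe, ← sub_eq_zero, ← AddCircle.coe_sub, AddCircle.coe_eq_zero_iff] at hij
    obtain ⟨m, hm⟩ := hij
    simp only [zsmul_eq_mul, mul_one] at hm
    have : k = l + m * n := hq.injective (by rw [hper']; linarith)
    simp [this]
  · obtain ⟨k, rfl⟩ := ZMod.intCast_surjective i
    have h1 := hval (k + 1)
    have h2 : q k ≤ q (k + 1) := hq.monotone (by omega)
    push_cast at h1
    rw [h1, hval, add_div]
    linarith
  · show p k = _
    rw [hval, hcoe, sub_add_cancel]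

theorem hasRotationIndex (hn : 2 < n) {p : ZMod n → UnitAddCircle} (hp : IsClockwise p)
    (d : ZMod n → Dir) : HasRotationIndex p d (rotation d : ℤ) := by
  obtain ⟨hinj, z, hz⟩ := hp.exists_lifts
  obtain ⟨p₀, hp₀⟩ := exists_round hn d hz hinj
  refine fun p' => ⟨fun h => h.eq_rotation hz hinj, fun h => ?_⟩
  have : p' = p₀ := funext fun i => (h i).trans (hp₀.eq_rotation hz hinj i).symm
  rwa [this]

end

section

variable {N n : ℕ}

theorem Network.history_succ (A : Network N n) (x : ℕ → ZMod n → UnitAddCircle) (t : ℕ)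
    (i : ZMod n) : A.history x (t + 1) i =
      A.history x t i ++ [rightDist (A.aligned i) (x t i) (x (t + 1) i)] := by
  simp [Network.history, List.range_succ]

theorem Network.length_history (A : Network N n) (x : ℕ → ZMod n → UnitAddCircle) (t : ℕ)
    (i : ZMod n) : (A.history x t i).length = t := by
  simp [Network.history]


theorem IsClockwise.rotate {p : ZMod n → UnitAddCircle} (h : IsClockwise p) (o : ZMod n) :
    IsClockwise fun i => p (i + o) := by
  obtain ⟨q, hq, hper, hcoe⟩ := h
  obtain ⟨c, rfl⟩ := ZMod.intCast_surjective o
  refine ⟨fun k => q (k + c), hq.comp fun a b h => by simpa using h, fun k => ?_, fun k => ?_⟩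
  · simp only [add_right_comm k, hper]
  · rw [← hcoe]
    push_cast
    rfl

/-! ### Executions -/

theorem coe_rightDist (b : Bool) (x y : UnitAddCircle) :
    (rightDist b x y : UnitAddCircle) = if b then y - x else x - y := by
  cases b <;> simp only [rightDist, if_true, Bool.false_eq_true, if_false]
  · exact (AddCircle.equivIco 1 0).symm_apply_apply (x - y)
  · exact (AddCircle.equivIco 1 0).symm_apply_apply (y - x)

/-- Modulo 1 the observations add up to the net displacement, up to the agent's unknown orientation;
the sign does not affect whether it vanishes. -/
theorem Network.coe_sum_history (A : Network N n) (x : ℕ → ZMod n → UnitAddCircle) (t : ℕ)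
    (i : ZMod n) : ((A.history x t i).sum : UnitAddCircle) =
      if A.aligned i then x t i - x 0 i else x 0 i - x t i := by
  induction t with
  | zero => simp [Network.history]
  | succ t ih =>
    rw [A.history_succ, List.sum_append, AddCircle.coe_add, ih, List.sum_singleton, coe_rightDist]
    split_ifs <;> abel

theorem Network.coe_sum_history_eq_zero (A : Network N n) {x : ℕ → ZMod n → UnitAddCircle}
    {t : ℕ} {i : ZMod n} : ((A.history x t i).sum : UnitAddCircle) = 0 ↔ x t i = x 0 i := by
  rw [A.coe_sum_history]
  split_ifs
  · exact sub_eq_zero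
  · rw [sub_eq_zero, eq_comm]

variable [NeZero n]

theorem isNontrivialMove (hn : 2 < n) {p : ZMod n → UnitAddCircle} (hp : IsClockwise p)
    {d : ZMod n → Dir} (hd : 2 * ((rotation d : ℤ) : ZMod n) ≠ 0) : IsNontrivialMove p d := by
  refine ⟨_, hasRotationIndex hn hp d, fun h => hd ?_, fun h => hd ?_⟩
  · rw [ZMod.val_eq_zero] at h
    rw [h, mul_zero]
  · have := congrArg (Nat.cast : ℕ → ZMod n) h
    simpa using this

/-- The positions of the agents and their observations after `t` rounds of the protocol `P`. -/
noncomputable def Protocol.run (P : Protocol) (A : Network N n) :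
    ℕ → (ZMod n → UnitAddCircle) × (ZMod n → List ℝ)
  | 0 => (A.pos, fun _ => [])
  | t + 1 =>
    let s := P.run A t
    let c := rotation fun i => objective (A.aligned i) (P.dir (A.id i) (s.2 i))
    (fun i => s.1 (i + c),
      fun i => s.2 i ++ [rightDist (A.aligned i) (s.1 i) (s.1 (i + c))])

theorem Protocol.history_run (P : Protocol) (A : Network N n) (t : ℕ) (i : ZMod n) :
    A.history (fun t => (P.run A t).1) t i = (P.run A t).2 i := by
  induction t with
  | zero => simp [Network.history, Protocol.run]
  | succ t ih => rw [A.history_succ, ih]; rfl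

theorem Protocol.IsExecution.exists_rotate {P : Protocol} {A : Network N n} (hn : 2 < n)
    {x : ℕ → ZMod n → UnitAddCircle} (hx : P.IsExecution A x) (t : ℕ) :
    x t = fun i => A.pos (i + ((∑ s ∈ Finset.range t, rotation (P.directions A x s) : ℤ))) := by
  induction t with
  | zero => simp [hx.1]
  | succ t ih =>
    funext i
    have hcw : IsClockwise (x t) := ih ▸ A.clockwise.rotate _
    rw [(hasRotationIndex hn hcw _ _).1 (hx.2 t) i, ih, Finset.sum_range_succ]
    push_cast
    congr 1
    ring

theorem Protocol.exists_isExecution (P : Protocol) (A : Network N n) (hn : 2 < n) :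
    ∃ x, P.IsExecution A x := by
  have hcw : ∀ t, IsClockwise (P.run A t).1 := by
    intro t
    induction t with
    | zero => exact A.clockwise
    | succ t ih => exact ih.rotate _
  refine ⟨fun t => (P.run A t).1, rfl, fun t => ?_⟩
  refine (hasRotationIndex hn (hcw t) _ _).2 fun i => ?_
  have : P.directions A (fun t => (P.run A t).1) t =
      fun i => objective (A.aligned i) (P.dir (A.id i) ((P.run A t).2 i)) :=
    funext fun i => by rw [Protocol.directions, P.history_run]
  rw [this]
  rfl

/-! ### The protocol -/

open Classical in
/-- The own direction of an agent that goes right if its identifier is in `S`. -/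
noncomputable def choice (S : Finset ℕ) (a : ℕ) : Dir := if a ∈ S then .right else .left

/-- The directions in which the agents start if those with an identifier in `S` go to their own
right. -/
noncomputable def Network.split (A : Network N n) (S : Finset ℕ) (i : ZMod n) : Dir :=
  objective (A.aligned i) (choice S (A.id i))

open Classical in
/-- The sets `f 0, f 1, …` are tried out, each in two rounds. An agent terminates as soon as after
such a pair of rounds it is not back at its initial position. -/
noncomputable def testing (f : ℕ → Finset ℕ) : Protocol where
  dir a h := choice
    (if Even h.length ∧ (h.sum : UnitAddCircle) ≠ 0 then f (h.length / 2 - 1)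
      else f (h.length / 2)) a
  terminated _ h := Even h.length ∧ (h.sum : UnitAddCircle) ≠ 0

/-- The offset `o t` from the initial positions is common to all agents, so they take every decision
in unison; the first good set stops them. -/
theorem testing_solves (f : ℕ → Finset ℕ) (A : Network N n) (hn : 2 < n) {j : ℕ}
    (hj : 2 * ((rotation (A.split (f j)) : ℤ) : ZMod n) ≠ 0) {T : ℝ} (hT : 2 * (j : ℝ) + 2 ≤ T) :
    (testing f).SolvesNontrivialMove A T := by
  refine ⟨Protocol.exists_isExecution _ A hn, fun x hx => ?_⟩
  classical
  obtain ⟨k, hkj, hk, hmin⟩ : ∃ k ≤ j, 2 * ((rotation (A.split (f k)) : ℤ) : ZMod n) ≠ 0 ∧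
      ∀ l < k, 2 * ((rotation (A.split (f l)) : ℤ) : ZMod n) = 0 := by
    have hex : ∃ k, 2 * ((rotation (A.split (f k)) : ℤ) : ZMod n) ≠ 0 := ⟨j, hj⟩
    exact ⟨Nat.find hex, Nat.find_min' hex hj, Nat.find_spec hex,
      fun l hl => not_not.1 (Nat.find_min hex hl)⟩
  have hpos := fun t => Protocol.IsExecution.exists_rotate hn hx t
  set o : ℕ → ZMod n := fun t =>
    ((∑ s ∈ Finset.range t, rotation ((testing f).directions A x s) : ℤ) : ZMod n) with ho
  have hosucc : ∀ t, o (t + 1) = o t + (rotation ((testing f).directions A x t) : ℤ) := by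
    intro t
    simp only [ho, Finset.sum_range_succ, Int.cast_add]
  have hback : ∀ t i, ((A.history x t i).sum : UnitAddCircle) = 0 ↔ o t = 0 := by
    intro t i
    rw [A.coe_sum_history_eq_zero, hpos t, hx.1, A.clockwise.exists_lifts.1.eq_iff, add_eq_left]
  have hterm : ∀ t i, (testing f).terminated (A.id i) (A.history x t i) ↔ Even t ∧ o t ≠ 0 := by
    intro t i
    simp only [testing, A.length_history, Ne, hback]
  have hdir : ∀ t, (testing f).directions A x t =
      A.split (if Even t ∧ o t ≠ 0 then f (t / 2 - 1) else f (t / 2)) := by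
    intro t
    funext i
    simp only [Protocol.directions, testing, A.length_history, Ne, hback, Network.split]
  -- At odd times termination is not considered, so the second round of a pair repeats the set of
  -- the first.
  have hodd : ∀ l, (testing f).directions A x (2 * l + 1) = A.split (f l) := by
    intro l
    rw [hdir, if_neg (fun h => by have := h.1; grind), show (2 * l + 1) / 2 = l by omega]
  have hstep : ∀ l, o (2 * l) = 0 →
      o (2 * (l + 1)) = 2 * ((rotation (A.split (f l)) : ℤ) : ZMod n) := by
    intro l hl
    rw [show 2 * (l + 1) = 2 * l + 1 + 1 by ring, hosucc, hosucc, hodd, hdir,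
      if_neg (fun h => h.2 hl), show 2 * l / 2 = l by omega, hl]
    ring
  have hzero : ∀ l ≤ k, o (2 * l) = 0 := by
    intro l
    induction l with
    | zero => simp [ho]
    | succ l ih => exact fun h => (hstep l (ih (by omega))).trans (hmin l (by omega))
  have hk1 : o (2 * (k + 1)) ≠ 0 := by rwa [hstep k (hzero k le_rfl)]
  have heven : Even (2 * (k + 1)) := even_two_mul _
  refine ⟨2 * (k + 1), ?_, fun s hs i => ?_, fun i => (hterm _ i).2 ⟨heven, hk1⟩, ?_⟩
  · have : (k : ℝ) ≤ j := by exact_mod_cast hkj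
    push_cast
    linarith
  · rw [hterm]
    rintro ⟨⟨l, rfl⟩, h⟩
    rw [← two_mul] at h hs
    exact h (hzero l (by omega))
  -- On termination the directions revert to the set just tested, hence the `- 1` in `testing`.
  · rw [hdir, if_pos ⟨heven, hk1⟩, show 2 * (k + 1) / 2 - 1 = k by omega, hpos]
    exact isNontrivialMove hn (A.clockwise.rotate _) hk

end

/-! ### Sequences of sets -/

/-- If a random element is bad for `i` with probability at most `p i`, and `∑ i, p i ^ m i < 1`,
then some sequence has a good element for every `i` among its first `m i` members. -/
theorem exists_hitting_sequence {ι Ω : Type*} {W : Finset Ω} (hW : W.Nonempty)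
    (good : ι → Ω → Prop) [∀ i, DecidablePred (good i)] {p : ι → ℝ} (hp0 : ∀ i, 0 ≤ p i) (M : ℕ) :
    ∀ (I : Finset ι) (m : ι → ℕ),
      (∀ i ∈ I, ((W.filter fun w => ¬ good i w).card : ℝ) ≤ p i * W.card) →
      (∀ i ∈ I, m i ≤ M) → ∑ i ∈ I, p i ^ m i < 1 →
      ∃ f : ℕ → Ω, ∀ i ∈ I, ∃ j < m i, good i (f j) := by
  have hpos : ∀ (I : Finset ι) (m : ι → ℕ), ∑ i ∈ I, p i ^ m i < 1 → ∀ i ∈ I, m i ≠ 0 := by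
    intro I m hlt i hi h0
    have := Finset.single_le_sum (f := fun i => p i ^ m i) (fun i _ => pow_nonneg (hp0 i) _) hi
    simp only [h0, pow_zero] at this
    linarith
  induction M with
  | zero =>
    intro I m _ hm hlt
    exact ⟨fun _ => hW.choose, fun i hi => absurd (Nat.le_zero.1 (hm i hi)) (hpos I m hlt i hi)⟩
  | succ M ih =>
    intro I m hI hm hlt
    have hm0 := hpos I m hlt
    -- Conditional expectations: averaged over `w`, the sum that remains is at most the present one,
    -- so some `w` keeps it below 1.
    obtain ⟨w, -, hw⟩ : ∃ w ∈ W, ∑ i ∈ I.filter (fun i => ¬ good i w), p i ^ (m i - 1) < 1 := by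
      refine Finset.exists_lt_of_sum_lt (g := fun _ => (1 : ℝ)) ?_
      simp only [Finset.sum_filter]
      rw [Finset.sum_comm]
      calc ∑ i ∈ I, ∑ w ∈ W, (if ¬ good i w then p i ^ (m i - 1) else 0)
          = ∑ i ∈ I, (W.filter fun w => ¬ good i w).card * p i ^ (m i - 1) := by
            refine Finset.sum_congr rfl fun i _ => ?_
            rw [← Finset.sum_filter, Finset.sum_const, nsmul_eq_mul]
        _ ≤ ∑ i ∈ I, p i ^ m i * W.card := by
            refine Finset.sum_le_sum fun i hi => ?_
            calc _ ≤ p i * W.card * p i ^ (m i - 1) :=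
                  mul_le_mul_of_nonneg_right (hI i hi) (pow_nonneg (hp0 i) _)
              _ = p i ^ m i * W.card := by
                  rw [mul_right_comm, mul_pow_sub_one (hm0 i hi)]
        _ < ∑ _w ∈ W, 1 := by
            rw [← Finset.sum_mul, Finset.sum_const, nsmul_eq_mul, mul_one]
            exact mul_lt_of_lt_one_left (Nat.cast_pos.2 hW.card_pos) hlt
    obtain ⟨f, hf⟩ := ih (I.filter fun i => ¬ good i w) (fun i => m i - 1)
      (fun i hi => hI i (Finset.mem_filter.1 hi).1)
      (fun i hi => by have := hm i (Finset.mem_filter.1 hi).1; omega) hw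
    refine ⟨fun j => Nat.casesOn j w f, fun i hi => ?_⟩
    by_cases hg : good i w
    · exact ⟨0, Nat.pos_of_ne_zero (hm0 i hi), hg⟩
    · obtain ⟨j, hj, hj'⟩ := hf i (Finset.mem_filter.2 ⟨hi, hg⟩)
      exact ⟨j + 1, by omega, hj'⟩

/-! ### Probability of a trivial move -/

/-- The number of subsets of an `n`-element set whose size is a multiple of `n / 4`. -/
def trivialCount (n : ℕ) : ℕ := ∑ l ∈ (Finset.range (n + 1)).filter (fun l => n ∣ 4 * l), n.choose l

/-- The probability that random directions of `n` agents give a trivial move. -/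
noncomputable def trivialProb (n : ℕ) : ℝ := trivialCount n / 2 ^ n

theorem card_powerset_filter_dvd (X : Finset ℕ) :
    (X.powerset.filter fun Y => X.card ∣ 4 * Y.card).card = trivialCount X.card := by
  rw [Finset.card_filter, Finset.sum_powerset_apply_card (fun l => if X.card ∣ 4 * l then 1 else 0),
    trivialCount, Finset.sum_filter]
  refine Finset.sum_congr rfl fun l _ => ?_
  simp

/-- Taking the symmetric difference with a fixed `A` preserves uniformity on `X`: `S ↦ (symmDiff A S
∩ X, S \ X)` is injective. -/
theorem card_bad_le {U X A : Finset ℕ} (hX : X ⊆ U) :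
    ((U.powerset.filter fun S => ¬ ¬ X.card ∣ 4 * (symmDiff A S ∩ X).card).card : ℝ) ≤
      trivialProb X.card * U.powerset.card := by
  have h : (U.powerset.filter fun S => ¬ ¬ X.card ∣ 4 * (symmDiff A S ∩ X).card).card ≤
      ((X.powerset.filter fun Y => X.card ∣ 4 * Y.card) ×ˢ (U \ X).powerset).card := by
    refine Finset.card_le_card_of_injOn (fun S => (symmDiff A S ∩ X, S \ X)) ?_ ?_
    · intro S hS
      simp only [Finset.coe_filter, Finset.mem_powerset, not_not, Set.mem_ofPred_eq] at hS
      simp only [Finset.coe_product, Set.mem_prod, Finset.mem_coe, Finset.mem_filter,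
        Finset.mem_powerset]
      exact ⟨⟨Finset.inter_subset_right, hS.2⟩, Finset.sdiff_subset_sdiff hS.1 le_rfl⟩
    · intro S _ S' _ h
      simp only [Prod.mk.injEq, Finset.ext_iff, Finset.mem_inter, Finset.mem_symmDiff,
        Finset.mem_sdiff] at h
      ext a
      have h1 := h.1 a
      have h2 := h.2 a
      tauto
  rw [Finset.card_product, card_powerset_filter_dvd, Finset.card_powerset,
    Finset.card_sdiff_of_subset hX] at h
  have hle := Finset.card_le_card hX
  rw [trivialProb, Finset.card_powerset, div_mul_eq_mul_div, le_div_iff₀ (by positivity)]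
  calc _ ≤ ((trivialCount X.card * 2 ^ (U.card - X.card) : ℕ) : ℝ) * 2 ^ X.card := by
        gcongr
    _ = _ := by
        push_cast
        rw [mul_assoc, ← pow_add, Nat.sub_add_cancel hle]

/-- If `4 * l = c * n` then `c ≤ 4`; the extremes `l = 0, n` count once each, the other three at
most as the middle coefficient. -/
theorem trivialCount_le {n : ℕ} (hn : 0 < n) : trivialCount n ≤ 2 + 3 * n.choose (n / 2) := by
  have hsub : (Finset.range (n + 1)).filter (fun l => n ∣ 4 * l) ⊆
      {0, n} ∪ {n / 4, n / 2, 3 * n / 4} := by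
    intro l hl
    simp only [Finset.mem_filter, Finset.mem_range] at hl
    obtain ⟨hl, c, hc⟩ := hl
    have hc4 : c ≤ 4 := by
      by_contra! h
      nlinarith
    simp only [Finset.mem_union, Finset.mem_insert, Finset.mem_singleton]
    interval_cases c <;> omega
  calc trivialCount n ≤ ∑ l ∈ {0, n} ∪ {n / 4, n / 2, 3 * n / 4}, n.choose l :=
        Finset.sum_le_sum_of_subset hsub
    _ ≤ ∑ l ∈ {0, n}, n.choose l + ∑ l ∈ {n / 4, n / 2, 3 * n / 4}, n.choose l := by
        rw [← Finset.sum_union_inter]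
        exact Nat.le_add_right _ _
    _ ≤ 2 + 3 * n.choose (n / 2) := by
        refine Nat.add_le_add ?_ ?_
        · rw [Finset.sum_pair hn.ne]
          simp
        · refine (Finset.sum_le_card_nsmul _ _ _ fun l _ => Nat.choose_le_middle l n).trans ?_
          rw [smul_eq_mul]
          exact Nat.mul_le_mul_right _ Finset.card_le_three

theorem choose_half_succ_le (n : ℕ) :
    (n + 1).choose ((n + 1) / 2) ≤ 2 * n.choose (n / 2) := by
  rcases Nat.eq_zero_or_pos ((n + 1) / 2) with h | h
  · rw [h]
    have := Nat.choose_pos (Nat.div_le_self n 2)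
    simp
    omega
  · obtain ⟨k, hk⟩ := Nat.exists_eq_succ_of_ne_zero h.ne'
    rw [hk, Nat.succ_eq_add_one, Nat.choose_succ_succ, two_mul]
    exact Nat.add_le_add (Nat.choose_le_middle _ _) (Nat.choose_le_middle _ _)

theorem trivialProb_le {n : ℕ} (hn : 4 < n) : trivialProb n ≤ 31 / 32 := by
  have key : 32 * trivialCount n ≤ 31 * 2 ^ n := by
    -- The bound `2 + 3 * n.choose (n / 2)` is useless at 5, and at 6 gives exactly `62 / 64 = 31 /
    -- 32`; from there on the middle coefficient at most doubles.
    obtain rfl | hn6 : n = 5 ∨ 6 ≤ n := by omega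
    · decide
    have h : 32 * (2 + 3 * n.choose (n / 2)) ≤ 31 * 2 ^ n := by
      induction n, hn6 using Nat.le_induction with
      | base => decide
      | succ n h6 ih =>
        have := choose_half_succ_le n
        have := ih (by omega)
        rw [pow_succ]
        omega
    exact (Nat.mul_le_mul_left _ (trivialCount_le (by omega))).trans h
  rw [trivialProb, div_le_div_iff₀ (by positivity) (by norm_num)]
  exact_mod_cast (mul_comm _ _).trans_le key

/-- A square-root-free form of `centralBinom k ≤ 4 ^ k / √(2k + 1)`; the induction step is `(2k +
1)(2k + 3) ≤ 4(k + 1)²`. -/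
theorem centralBinom_sq_mul_le (k : ℕ) : k.centralBinom ^ 2 * (2 * k + 1) ≤ 16 ^ k := by
  induction k with
  | zero => simp
  | succ k ih =>
    have h := Nat.succ_mul_centralBinom_succ k
    refine Nat.le_of_mul_le_mul_left ?_ (show 0 < (k + 1) ^ 2 by positivity)
    calc (k + 1) ^ 2 * ((k + 1).centralBinom ^ 2 * (2 * (k + 1) + 1))
        = ((k + 1) * (k + 1).centralBinom) ^ 2 * (2 * k + 3) := by ring
      _ = (k.centralBinom ^ 2 * (2 * k + 1)) * (4 * ((2 * k + 1) * (2 * k + 3))) := by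
          rw [h]; ring
      _ ≤ 16 ^ k * (16 * (k + 1) ^ 2) := by
          refine Nat.mul_le_mul ih ?_
          nlinarith
      _ = (k + 1) ^ 2 * 16 ^ (k + 1) := by ring

theorem choose_half_sq_mul_le (n : ℕ) : n.choose (n / 2) ^ 2 * n ≤ 4 ^ n := by
  obtain ⟨k, rfl | rfl⟩ := n.even_or_odd'
  · have h := centralBinom_sq_mul_le k
    rw [Nat.centralBinom] at h
    rw [Nat.mul_div_cancel_left _ two_pos, pow_mul]
    norm_num
    nlinarith
  · have h := centralBinom_sq_mul_le (k + 1)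
    have h1 : (k + 1).centralBinom = 2 * (2 * k + 1).choose k := by
      rw [Nat.centralBinom_eq_two_mul_choose, show 2 * (k + 1) = 2 * k + 1 + 1 by ring,
        Nat.choose_succ_succ, Nat.choose_symm_half]
      ring
    have h4 : 4 ^ (2 * k + 1) = 16 ^ k * 4 := by
      rw [pow_succ, pow_mul]
      norm_num
    rw [show (2 * k + 1) / 2 = k by omega, h4]
    rw [h1, mul_pow, pow_succ 16] at h
    nlinarith [Nat.zero_le ((2 * k + 1).choose k ^ 2)]

theorem trivialProb_le_div_sqrt {n : ℕ} (hn : 4 < n) : trivialProb n ≤ 4 / √n := by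
  have hn0 : 0 < √(n : ℝ) := Real.sqrt_pos.2 (by positivity)
  have h1 : trivialCount n ≤ 4 * n.choose (n / 2) := by
    have h2 : n ≤ n.choose (n / 2) := by simpa using Nat.choose_le_middle 1 n
    have := trivialCount_le (show 0 < n by omega)
    omega
  have h2 : (n.choose (n / 2) : ℝ) * √n ≤ 2 ^ n := by
    refine abs_le_of_sq_le_sq' ?_ (by positivity) |>.2
    rw [mul_pow, Real.sq_sqrt (by positivity), ← pow_mul, mul_comm n 2, pow_mul]
    norm_num
    exact_mod_cast choose_half_sq_mul_le n
  rw [trivialProb, div_le_div_iff₀ (by positivity) hn0]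
  calc (trivialCount n : ℝ) * √n ≤ (4 * n.choose (n / 2) : ℕ) * √n := by gcongr
    _ = 4 * (n.choose (n / 2) * √n) := by push_cast; ring
    _ ≤ 4 * 2 ^ n := by gcongr

theorem trivialProb_nonneg (n : ℕ) : 0 ≤ trivialProb n := by
  unfold trivialProb
  positivity

/-- For `n ≤ 256`, `log n / 256 < 1 / 32` and the constant bound suffices; beyond, `4 / √n` does. -/
theorem trivialProb_le_exp {n : ℕ} (hn : 4 < n) :
    trivialProb n ≤ Real.exp (-(Real.log n / 256)) := by
  have hn0 : (0 : ℝ) < n := by positivity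
  have h2 := Real.log_two_lt_d9
  have h2' := Real.log_two_gt_d9
  have h256 : Real.log 256 = 8 * Real.log 2 := by
    rw [show (256 : ℝ) = 2 ^ 8 by norm_num, Real.log_pow]
    norm_num
  rcases le_total n 256 with h | h
  · have hlog : Real.log n ≤ Real.log 256 := Real.log_le_log hn0 (by exact_mod_cast h)
    have := Real.add_one_le_exp (-(Real.log n / 256))
    have := trivialProb_le hn
    linarith
  · have hlog : Real.log 256 ≤ Real.log n := Real.log_le_log (by norm_num) (by exact_mod_cast h)
    refine (trivialProb_le_div_sqrt hn).trans ?_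
    have h4 : (4 : ℝ) = Real.exp (2 * Real.log 2) := by
      rw [two_mul, Real.exp_add, Real.exp_log two_pos]
      norm_num
    have hs : √(n : ℝ) = Real.exp (Real.log n / 2) := by
      rw [Real.exp_half, Real.exp_log hn0]
    rw [h4, hs, ← Real.exp_sub, Real.exp_le_exp]
    linarith

/-! ### The union bound over networks -/

/-- The time bound of the theorem, up to a constant factor. -/
noncomputable def timeScale (N n : ℕ) : ℝ :=
  (n : ℝ) * (1 + Real.log ((N : ℝ) / (n : ℝ))) / Real.log (n : ℝ)

theorem log_div_nonneg {N n : ℕ} (hn : 0 < n) (hN : n ≤ N) : 0 ≤ Real.log ((N : ℝ) / n) := by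
  refine Real.log_nonneg ?_
  rw [one_le_div (by positivity)]
  exact_mod_cast hN

theorem one_le_timeScale {N n : ℕ} (hn : 4 < n) (hN : n ≤ N) : 1 ≤ timeScale N n := by
  have hl := log_div_nonneg (by omega) hN
  have hn0 : (0 : ℝ) < n := by positivity
  have h0 : 0 < Real.log n := Real.log_pos (by exact_mod_cast (by omega : 1 < n))
  rw [timeScale, one_le_div h0]
  have := Real.log_le_sub_one_of_pos hn0
  nlinarith

theorem choose_le_exp {N n : ℕ} (hn : 0 < n) (hN : n ≤ N) :
    (N.choose n : ℝ) ≤ Real.exp (n * (1 + Real.log ((N : ℝ) / n))) := by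
  have hn0 : (0 : ℝ) < n := by positivity
  have hN0 : (0 : ℝ) < N := by exact_mod_cast hn.trans_le hN
  calc (N.choose n : ℝ) ≤ (N : ℝ) ^ n / n.factorial := Nat.choose_le_pow_div n N
    _ = ((N : ℝ) / n) ^ n * ((n : ℝ) ^ n / n.factorial) := by
        rw [div_pow]
        field_simp
    _ ≤ Real.exp (n * Real.log ((N : ℝ) / n)) * Real.exp n := by
        refine mul_le_mul (le_of_eq ?_) (Real.pow_div_factorial_le_exp _ hn0.le n)
          (by positivity) (Real.exp_pos _).le
        rw [Real.exp_nat_mul, Real.exp_log (by positivity)]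
    _ = _ := by
        rw [← Real.exp_add]
        ring_nf

/-- The number of sets that are tried out until a nontrivial move is found. -/
noncomputable def trials (N n : ℕ) : ℕ := ⌈1024 * timeScale N n⌉₊

/-- The factor `1024 = 4 * 256` makes the failure probability at most `exp (-4 n (1 + lam))`.
Counting pairs costs `exp (n (1 + lam) + n)`, and what is left is still geometric in `n`, hence
summable over all sizes. -/
theorem choose_mul_pow_le {N n : ℕ} (hn : 4 < n) (hN : n ≤ N) :
    (N.choose n : ℝ) * (2 ^ n * trivialProb n ^ trials N n) ≤ (1 / 2) ^ (n + 1) := by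
  have hl := log_div_nonneg (by omega) hN
  have hn0 : (0 : ℝ) < n := by positivity
  have h0 : 0 < Real.log n := Real.log_pos (by exact_mod_cast (by omega : 1 < n))
  have he : (2 : ℝ) ≤ Real.exp 1 := by linarith [Real.add_one_le_exp 1]
  set lam := Real.log ((N : ℝ) / n)
  have hscale : timeScale N n * Real.log n = n * (1 + lam) := div_mul_cancel₀ _ h0.ne'
  have hpow : trivialProb n ^ trials N n ≤ Real.exp (-(4 * (n * (1 + lam)))) := by
    refine (pow_le_pow_left₀ (trivialProb_nonneg n) (trivialProb_le_exp hn) _).trans ?_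
    rw [← Real.exp_nat_mul, Real.exp_le_exp]
    have h1 : 1024 * timeScale N n ≤ trials N n := Nat.le_ceil _
    have h2 := mul_le_mul_of_nonneg_right h1 h0.le
    rw [mul_assoc, hscale] at h2
    linarith
  have htwo : (2 : ℝ) ^ n ≤ Real.exp n := by
    rw [← mul_one (n : ℝ), Real.exp_nat_mul]
    exact pow_le_pow_left₀ zero_le_two he n
  calc (N.choose n : ℝ) * (2 ^ n * trivialProb n ^ trials N n)
      ≤ Real.exp (n * (1 + lam)) * (Real.exp n * Real.exp (-(4 * (n * (1 + lam))))) := by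
        have := trivialProb_nonneg n
        have := choose_le_exp (by omega) hN
        gcongr
    _ = Real.exp (n + -(3 * (n * (1 + lam)))) := by
        rw [← Real.exp_add, ← Real.exp_add]
        ring_nf
    _ ≤ Real.exp (((n + 1 : ℕ) : ℝ) * (-1)) := by
        rw [Real.exp_le_exp]
        push_cast
        have : (1 : ℝ) ≤ n := by exact_mod_cast (by omega : 1 ≤ n)
        nlinarith [mul_nonneg hn0.le hl]
    _ ≤ (1 / 2) ^ (n + 1) := by
        rw [Real.exp_nat_mul, Real.exp_neg, one_div]
        gcongr

theorem sum_pow_trials_lt_one (N : ℕ) :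
    ∑ i ∈ ((Finset.Icc 1 N).powerset.filter fun X => 4 < X.card).sigma fun X => X.powerset,
      trivialProb i.1.card ^ trials N i.1.card < 1 := by
  rw [Finset.sum_sigma]
  simp only [Finset.sum_const, Finset.card_powerset, nsmul_eq_mul]
  rw [Finset.sum_filter, Finset.sum_powerset_apply_card (fun n =>
    if 4 < n then ((2 ^ n : ℕ) : ℝ) * trivialProb n ^ trials N n else 0), Nat.card_Icc,
    Nat.add_sub_cancel]
  calc _ ≤ ∑ n ∈ Finset.range (N + 1), (1 / 2 : ℝ) ^ (n + 1) := by
        refine Finset.sum_le_sum fun n hn => ?_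
        split_ifs with h
        · rw [nsmul_eq_mul]
          push_cast
          exact choose_mul_pow_le h (Nat.lt_succ_iff.1 (Finset.mem_range.1 hn))
        · rw [smul_zero]
          positivity
    _ = 1 - (1 / 2) ^ (N + 1) := by
        induction N + 1 with
        | zero => simp
        | succ m ih => rw [Finset.sum_range_succ, ih]; ring
    _ < 1 := by
        rw [sub_lt_self_iff]
        positivity

/-! ### From sets of identifiers to the protocol -/

theorem rotation_eq {n : ℕ} [NeZero n] (d : ZMod n → Dir) [DecidablePred fun i => d i = Dir.left] :
    rotation d = n - 2 * (Finset.univ.filter fun i => d i = Dir.left).card := by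
  have h : ∀ i, (d i).sign = 1 - 2 * if d i = Dir.left then 1 else 0 := by
    intro i
    split_ifs with hd
    · simp [hd, Dir.sign]
    · have : d i = Dir.right := by
        generalize d i = e at hd
        cases e
        · exact absurd rfl hd
        · rfl
      simp [this, Dir.sign]
  rw [rotation, Finset.sum_congr rfl fun i _ => h i, Finset.sum_sub_distrib, ← Finset.mul_sum,
    Finset.sum_boole]
  simp [ZMod.card]

/-- An agent goes objectively left iff exactly one of "aligned" and "in `S`" holds, whence the
symmetric difference; and `2 * (n - 2 * l) = -4 * l` modulo `n`. -/
theorem two_mul_rotation_split_ne_zero {N n : ℕ} [NeZero n] (A : Network N n) {S : Finset ℕ}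
    (h : ¬ n ∣ 4 * (symmDiff ((Finset.univ.filter fun i => A.aligned i).image A.id) S ∩
      Finset.univ.image A.id).card) : 2 * ((rotation (A.split S) : ℤ) : ZMod n) ≠ 0 := by
  classical
  have hset : symmDiff ((Finset.univ.filter fun i => A.aligned i).image A.id) S ∩
      Finset.univ.image A.id = (Finset.univ.filter fun i => A.split S i = Dir.left).image A.id := by
    ext a
    simp only [Finset.mem_inter, Finset.mem_symmDiff, Finset.mem_image, Finset.mem_filter,
      Finset.mem_univ, true_and]
    constructor
    · rintro ⟨h, i, rfl⟩
      refine ⟨i, ?_, rfl⟩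
      simp only [A.id_injective.eq_iff, exists_eq_right] at h
      by_cases hS : A.id i ∈ S <;> cases hal : A.aligned i <;>
        simp_all [Network.split, objective, choice, Dir.opp]
    · rintro ⟨i, h, rfl⟩
      refine ⟨?_, i, rfl⟩
      simp only [A.id_injective.eq_iff, exists_eq_right]
      by_cases hS : A.id i ∈ S <;> cases hal : A.aligned i <;>
        simp_all [Network.split, objective, choice, Dir.opp]
  rw [hset, Finset.card_image_of_injective _ A.id_injective] at h
  intro h0
  refine h ?_
  rw [rotation_eq] at h0
  rw [← ZMod.natCast_eq_zero_iff]
  push_cast at h0 ⊢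
  rw [ZMod.natCast_self] at h0
  linear_combination -h0

theorem exists_protocol (N : ℕ) : ∃ P : Protocol, ∀ n : ℕ, 4 < n → n ≤ N →
    ∀ A : Network N n, P.SolvesNontrivialMove A (2050 * timeScale N n) := by
  classical
  set I := ((Finset.Icc 1 N).powerset.filter fun X => 4 < X.card).sigma fun X => X.powerset with hI
  have hbad : ∀ i ∈ I, (((Finset.Icc 1 N).powerset.filter fun S =>
      ¬ ¬ i.1.card ∣ 4 * (symmDiff i.2 S ∩ i.1).card).card : ℝ) ≤
        trivialProb i.1.card * (Finset.Icc 1 N).powerset.card := by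
    intro i hi
    simp only [hI, Finset.mem_sigma, Finset.mem_filter, Finset.mem_powerset] at hi
    exact card_bad_le hi.1.1
  obtain ⟨f, hf⟩ := exists_hitting_sequence (Finset.powerset_nonempty (Finset.Icc 1 N))
    (fun (i : Σ _ : Finset ℕ, Finset ℕ) S => ¬ i.1.card ∣ 4 * (symmDiff i.2 S ∩ i.1).card)
    (p := fun i => trivialProb i.1.card) (fun i => trivialProb_nonneg _)
    (I.sup fun i => trials N i.1.card) I (fun i => trials N i.1.card) hbad
    (fun i hi => Finset.le_sup (f := fun i : (Σ _ : Finset ℕ, Finset ℕ) => trials N i.1.card) hi)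
    (sum_pow_trials_lt_one N)
  refine ⟨testing f, fun n hn hN A => ?_⟩
  have : NeZero n := ⟨by omega⟩
  have hX : (Finset.univ.image A.id).card = n := by
    rw [Finset.card_image_of_injective _ A.id_injective, Finset.card_univ, ZMod.card]
  obtain ⟨j, hj, hgood⟩ := hf ⟨Finset.univ.image A.id,
    (Finset.univ.filter fun i => A.aligned i).image A.id⟩ (by
      simp only [hI, Finset.mem_sigma, Finset.mem_filter, Finset.mem_powerset]
      refine ⟨⟨Finset.image_subset_iff.2 fun i _ => A.id_mem i, hX.symm ▸ hn⟩,
        Finset.image_subset_image (Finset.filter_subset _ _)⟩)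
  simp only [hX] at hj hgood
  refine testing_solves f A (by omega) (two_mul_rotation_split_ne_zero A hgood) ?_
  -- Two rounds per trial cost at most `2 * (1024 * timeScale + 1)`, and `1 ≤ timeScale` absorbs the
  -- rounding into 2050.
  have h1 := one_le_timeScale hn hN
  have h2 : (trials N n : ℝ) < 1024 * timeScale N n + 1 := Nat.ceil_lt_add_one (by linarith)
  have h3 : (j : ℝ) + 1 ≤ trials N n := by exact_mod_cast hj
  linarith

end RingNetwork

theorem mainTheorem3 :
    ∃ C : ℝ,
      -- the number of agents is known: the protocol may depend on it
      (∀ N n : ℕ, 4 < n → n ≤ N → ∃ P : RingNetwork.Protocol,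
        ∀ A : RingNetwork.Network N n,
          P.SolvesNontrivialMove A
            (C * ((n : ℝ) * (1 + Real.log ((N : ℝ) / (n : ℝ))) / Real.log (n : ℝ)))) ∧
      -- the number of agents is unknown: one protocol for all of them
      (∀ N : ℕ, ∃ P : RingNetwork.Protocol,
        ∀ n : ℕ, 4 < n → n ≤ N → ∀ A : RingNetwork.Network N n,
          P.SolvesNontrivialMove A
            (C * ((n : ℝ) * (1 + Real.log ((N : ℝ) / (n : ℝ))) / Real.log (n : ℝ)))) := by
  refine ⟨2050, fun N n hn hN => ?_, RingNetwork.exists_protocol⟩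
  obtain ⟨P, hP⟩ := RingNetwork.exists_protocol N
  exact ⟨P, hP n hn hN⟩
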